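/- **Setting.** Let $X$ be a Banach space and $U$ a normed linear space (both real; a complex space is regarded as a real one). For each $t\ge 0$ let $A(t):D(A(t))\subset X\to X$ be a (possibly unbounded) linear operator, and let $F(t,\cdot,\cdot):E(t)\times U\to X$ be a (nonlinear) map defined for states in a subspace $E(t)\subset X$, e.g. a fractional power space of $-A(t)$. Consider $$\dot x(t)=A(t)x(t)+F(t,x(t),u(t)),\qquad x(0)=x_0, \tag{1}$$ with initial states $x_0\in D(A(0))$ and inputs $u\in U_c:=C([0,\infty);U)$. For $T\in(0,\infty]$, a classical solution of (1) on $[0,T)$ is a function $x$ with values in $X$ that is continuous on $[0,T)$, continuously differentiable on $(0,T)$, has $x(0)=x_0$, and for all $t\in(0,T)$ satisfies $x(t)\in D(A(t))\cap E(t)$ and the differential equation in (1). $\mathcal K$ is the set of continuous, strictly increasing $\gamma:[0,\infty)\to[0,\infty)$ with $\gamma(0)=0$; $\mathcal K_\infty$ is the set of unbounded $\gamma\in\mathcal K$; $\mathcal L$ is the set of continuous, strictly decreasing functions $[0,\infty)\to[0,\infty)$ with limit $0$ at infinity; $\mathcal{KL}$ is the set of continuous $\beta:[0,\infty)^2\to[0,\infty)$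 with $\beta(\cdot,t)\in\mathcal K$ for all $t\ge0$ and $\beta(r,\cdot)\in\mathcal L$ for all $r>0$. **Stability.** System (1) is *integral input-to-state stable* (iISS) if there are $\gamma\in\mathcal K$, $\sigma\in\mathcal K_\infty$, $\beta\in\mathcal{KL}$ such that for all $x_0\in D(A(0))$, $u\in U_c$, $T\in(0,\infty]$, every classical solution $x$ of (1) on $[0,T)$ satisfies $$\|x(t)\|_X\le\beta(\|x_0\|_X,t)+\sigma\Big(\int_0^t\gamma(\|u(s)\|_U)\,ds\Big)\qquad\text{for all }t\in[0,T). \tag{2}$$ It is *locally iISS* (LiISS) if there are $\gamma\in\mathcal K$, $\sigma\in\mathcal K_\infty$, $\beta\in\mathcal{KL}$, a constant $R>0$ and $\gamma_0\in\mathcal K$, $\sigma_0\in\mathcal K_\infty$ such that the same holds for all $(x_0,u)\in D(A(0))\times U_c$ with $\|x_0\|_X+\sigma_0\big(\int_0^t\gamma_0(\|u(s)\|_U)\,ds\big)\le R$ for all $t>0$. **Lyapunov functionals.** A continuously differentiable $V:[0,\infty)\times X\to[0,\infty)$ is an *LiISS Lyapunov functional* of (1) if 1. there are $\alpha_1,\alpha_2\in\mathcal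 K_\infty$ with $\alpha_1(\|x\|_X)\le V(t,x)\le\alpha_2(\|x\|_X)$ for all $x\in X$, $t\ge0$; 2. there are nonnegative locally integrable functions $g_1,g_2$ on $[0,\infty)$ with $\int_0^t g_1(\tau)\,d\tau\to\infty$ as $t\to\infty$ and $g_2(t)\le g_1(t)$ for all $t\ge0$, functions $\theta_1,\theta_2,\phi\in\mathcal K$ and a constant $R'>0$ with $\theta_2(s)\le\theta_1(s)$ for all $s\in[0,R']$, such that - either $\theta_2(s)<\theta_1(s)$ for all $s\in(0,R']$, or $\int_0^t(g_1(\tau)-g_2(\tau))\,d\tau\to\infty$ as $t\to\infty$ (the two rate terms do not cancel), and - for all $x_0\in D(A(0))$, $u\in U_c$, $T\in(0,\infty]$ and every classical solution $x$ of (1) on $[0,T)$, $$\frac{d}{dt}V(t,x(t))\le-g_1(t)\,\theta_1(\|x(t)\|_X)+g_2(t)\,\theta_2(\|x(t)\|_X)+\phi(\|u(t)\|_U)\qquad\text{for all }t\in(0,T).$$ If in addition $g_2\equiv0$ (in which case the second alternative in 2 holds automatically), $V$ is an *iISS Lyapunov functional*. **Theorem.** If system (1) admits an LiISS Lyapunov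 functional, then it is LiISS. If system (1) admits an iISS Lyapunov functional, then it is iISS. -/

import Mathlib

open Set Filter Topology MeasureTheory

/-- Class `K`: continuous and strictly increasing on `[0, ∞)`, zero at `0`
(hence nonnegative there). Only the values on `[0, ∞)` matter. -/
structure IsClassK (γ : ℝ → ℝ) : Prop where
  cont : ContinuousOn γ (Ici 0)
  strictMono : StrictMonoOn γ (Ici 0)
  zero : γ 0 = 0

/-- Class `K∞`: unbounded functions of class `K`. -/
structure IsClassKInf (γ : ℝ → ℝ) : Prop extends IsClassK γ where
  unbounded : ¬ BddAbove (γ '' Ici 0)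

/-- Class `L`: continuous and strictly decreasing on `[0, ∞)`, with limit `0` at infinity
(hence nonnegative there). -/
structure IsClassL (γ : ℝ → ℝ) : Prop where
  cont : ContinuousOn γ (Ici 0)
  strictAnti : StrictAntiOn γ (Ici 0)
  lim : Tendsto γ atTop (𝓝 0)

/-- Class `KL`: jointly continuous on `[0, ∞) × [0, ∞)`, of class `K` in the first variable,
of class `L` in the second variable for positive values of the first. -/
structure IsClassKL (β : ℝ → ℝ → ℝ) : Prop where
  cont : ContinuousOn (fun p : ℝ × ℝ => β p.1 p.2) (Ici 0 ×ˢ Ici 0)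
  classK : ∀ t, 0 ≤ t → IsClassK (fun r => β r t)
  classL : ∀ r, 0 < r → IsClassL (fun t => β r t)

/-- The data of a non-autonomous evolution equation `x' = A(t) x + F(t, x, u)`:
a family of (possibly unbounded) linear operators `A t` with domains `(A t).domain`, and a
nonlinearity `F t : E t × U → X`, where `E t` is a subspace of `X` (for instance a fractional
power space of `-A t`). -/
structure EvolutionSystem (X U : Type*) [NormedAddCommGroup X] [NormedSpace ℝ X] where
  A : ℝ → (X →ₗ.[ℝ] X)
  E : ℝ → Submodule ℝ X
  F : (t : ℝ) → E t → U → X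

namespace EvolutionSystem

variable {X U : Type*} [NormedAddCommGroup X] [NormedSpace ℝ X]

/-- `x` is a classical solution on `[0, T)`, `T ≤ ∞`, with initial state `x₀` and input `u`. -/
structure IsClassicalSolution (S : EvolutionSystem X U) (x₀ : X) (u : ℝ → U) (T : EReal)
    (x : ℝ → X) : Prop where
  init : x 0 = x₀
  cont : ContinuousOn x {t : ℝ | 0 ≤ t ∧ (t : EReal) < T}
  cont_deriv : ContinuousOn (deriv x) {t : ℝ | 0 < t ∧ (t : EReal) < T}
  ode : ∀ t : ℝ, 0 < t → (t : EReal) < T →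
    ∃ (hA : x t ∈ (S.A t).domain) (hE : x t ∈ S.E t),
      HasDerivAt x (S.A t ⟨x t, hA⟩ + S.F t ⟨x t, hE⟩ (u t)) t

variable [NormedAddCommGroup U]

/-- Every classical solution with initial state `x₀` and input `u`, global or not, satisfies
the integral input-to-state estimate as long as it exists. -/
def IISSEstimate (S : EvolutionSystem X U) (β : ℝ → ℝ → ℝ) (σ γ : ℝ → ℝ)
    (x₀ : X) (u : ℝ → U) : Prop :=
  ∀ (T : EReal) (x : ℝ → X), 0 < T → S.IsClassicalSolution x₀ u T x →
    ∀ t : ℝ, 0 ≤ t → (t : EReal) < T →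
      ‖x t‖ ≤ β ‖x₀‖ t + σ (∫ s in (0 : ℝ)..t, γ ‖u s‖)

/-- Integral input-to-state stability. -/
def IsIISS (S : EvolutionSystem X U) : Prop :=
  ∃ (γ σ : ℝ → ℝ) (β : ℝ → ℝ → ℝ), IsClassK γ ∧ IsClassKInf σ ∧ IsClassKL β ∧
    ∀ (x₀ : X) (u : ℝ → U), x₀ ∈ (S.A 0).domain → ContinuousOn u (Ici 0) →
      S.IISSEstimate β σ γ x₀ u

/-- Local integral input-to-state stability: the estimate holds for all data in a ball
`‖x₀‖ + σ₀ (∫₀ᵗ γ₀ ‖u‖) ≤ R`, `t > 0`. -/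
def IsLiISS (S : EvolutionSystem X U) : Prop :=
  ∃ (γ σ : ℝ → ℝ) (β : ℝ → ℝ → ℝ), IsClassK γ ∧ IsClassKInf σ ∧ IsClassKL β ∧
    ∃ (R : ℝ) (γ₀ σ₀ : ℝ → ℝ), 0 < R ∧ IsClassK γ₀ ∧ IsClassKInf σ₀ ∧
      ∀ (x₀ : X) (u : ℝ → U), x₀ ∈ (S.A 0).domain → ContinuousOn u (Ici 0) →
        (∀ t : ℝ, 0 < t → ‖x₀‖ + σ₀ (∫ s in (0 : ℝ)..t, γ₀ ‖u s‖) ≤ R) →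
        S.IISSEstimate β σ γ x₀ u

/-- `V` is a local integral input-to-state Lyapunov functional with decay and growth
coefficients `g₁`, `g₂`. The disjunction excludes that the
two rate terms cancel each other; it holds automatically when `g₂ = 0`. -/
structure IsLyapunovWith (S : EvolutionSystem X U) (V : ℝ → X → ℝ) (g₁ g₂ : ℝ → ℝ) : Prop where
  contDiff : ContDiffOn ℝ 1 (fun p : ℝ × X => V p.1 p.2) (Ici 0 ×ˢ univ)
  sandwich : ∃ α₁ α₂ : ℝ → ℝ, IsClassKInf α₁ ∧ IsClassKInf α₂ ∧
    ∀ (t : ℝ) (x : X), 0 ≤ t → α₁ ‖x‖ ≤ V t x ∧ V t x ≤ α₂ ‖x‖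
  nonneg₁ : ∀ t, 0 ≤ t → 0 ≤ g₁ t
  nonneg₂ : ∀ t, 0 ≤ t → 0 ≤ g₂ t
  locInt₁ : LocallyIntegrableOn g₁ (Ici 0)
  locInt₂ : LocallyIntegrableOn g₂ (Ici 0)
  integral_top : Tendsto (fun t : ℝ => ∫ τ in (0 : ℝ)..t, g₁ τ) atTop atTop
  le : ∀ t, 0 ≤ t → g₂ t ≤ g₁ t
  dissipation : ∃ (θ₁ θ₂ φ : ℝ → ℝ) (R' : ℝ), IsClassK θ₁ ∧ IsClassK θ₂ ∧ IsClassK φ ∧ 0 < R' ∧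
    (∀ s, 0 ≤ s → s ≤ R' → θ₂ s ≤ θ₁ s) ∧
    ((∀ s, 0 < s → s ≤ R' → θ₂ s < θ₁ s) ∨
      Tendsto (fun t : ℝ => ∫ τ in (0 : ℝ)..t, (g₁ τ - g₂ τ)) atTop atTop) ∧
    ∀ (x₀ : X) (u : ℝ → U) (T : EReal) (x : ℝ → X),
      x₀ ∈ (S.A 0).domain → ContinuousOn u (Ici 0) → 0 < T → S.IsClassicalSolution x₀ u T x →
      ∀ t : ℝ, 0 < t → (t : EReal) < T →
        deriv (fun τ => V τ (x τ)) t ≤ -g₁ t * θ₁ ‖x t‖ + g₂ t * θ₂ ‖x t‖ + φ ‖u t‖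

/-- `V` is an LiISS Lyapunov functional. -/
def IsLiISSLyapunov (S : EvolutionSystem X U) (V : ℝ → X → ℝ) : Prop :=
  ∃ g₁ g₂ : ℝ → ℝ, S.IsLyapunovWith V g₁ g₂

/-- `V` is an iISS Lyapunov functional: the case `g₂ ≡ 0`. -/
def IsIISSLyapunov (S : EvolutionSystem X U) (V : ℝ → X → ℝ) : Prop :=
  ∃ g₁ g₂ : ℝ → ℝ, S.IsLyapunovWith V g₁ g₂ ∧ ∀ t, 0 ≤ t → g₂ t = 0

end EvolutionSystem

/-!
Let `x` be a classical solution, `y t = V t (x t)` and `v t = φ ‖u t‖`, and suppose the dissipation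
inequality has the form `y' ≤ -g θ(‖x‖) + v` with a single rate `θ` and a single coefficient `g`.
Since `‖x‖ ≥ α₂⁻¹(y)`, it gives `y' ≤ -g a(y) + v` with `a = θ ∘ α₂⁻¹` monotone. The function
`w t = y t - ∫₀ᵗ v` is nonincreasing and lies below `y`, so `a (y s) ≥ a (w t)` for `s ≤ t`, and
integrating over `[0, t]` gives `w t + a (w t) * ∫₀ᵗ g ≤ y 0` (with `a` extended by zero). Hence
`w t` is at most the root `z` of `z + a z * q = y 0` for `q = ∫₀ᵗ g` (`le_decayRoot_add_integral`).
This root is jointly continuous, strictly increasing in `y 0`, nonincreasing in `q`, and tends to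
`0` as `q → ∞`, so it yields a function of class `KL` after adding a multiple of `exp (-t)`
(`IsDecayRate.isClassKL_decayRoot`); no comparison differential equation has to be solved. Applying
`α₁⁻¹` and the weak triangle inequality `α₁⁻¹(b + c) ≤ α₁⁻¹(2 b) + α₁⁻¹(2 c)` gives the estimate
(`exists_gains_of_dissipation`).

For an iISS Lyapunov functional `g = g₁` and `θ = θ₁` work globally. For an LiISS Lyapunov
functional, the inequality takes this form while `‖x‖ ≤ R'` (`exists_decayRate_of_domination`):
if `θ₂ < θ₁` on `(0, R']`, take `g = g₁` and for `θ` a monotone minorant of `θ₁ - θ₂`; if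
`∫ (g₁ - g₂) = ∞`, take `g = g₁ - g₂` and `θ = θ₁`. Solutions with small data never leave that
ball, because `V` grows by at most `∫ v` inside it and this is too little to reach the level
`α₁ R'` that `V` has on the sphere.
-/

/-! ### Comparison functions -/

theorem IsClassK.nonneg {γ : ℝ → ℝ} (h : IsClassK γ) {s : ℝ} (hs : 0 ≤ s) : 0 ≤ γ s :=
  h.zero ▸ h.strictMono.monotoneOn self_mem_Ici hs hs

theorem IsClassK.pos {γ : ℝ → ℝ} (h : IsClassK γ) {s : ℝ} (hs : 0 < s) : 0 < γ s :=
  h.zero ▸ h.strictMono self_mem_Ici hs.le hs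

theorem IsClassK.mono {γ : ℝ → ℝ} (h : IsClassK γ) {s t : ℝ} (hs : 0 ≤ s) (hst : s ≤ t) :
    γ s ≤ γ t :=
  h.strictMono.monotoneOn hs (hs.trans hst) hst

theorem isClassKInf_id : IsClassKInf (fun s : ℝ => s) where
  cont := continuousOn_id
  strictMono := strictMonoOn_id
  zero := rfl
  unbounded := by simpa using not_bddAbove_Ici (0 : ℝ)

theorem IsClassKInf.comp_two_mul {δ : ℝ → ℝ} (h : IsClassKInf δ) :
    IsClassKInf (fun s => δ (2 * s)) where
  cont := h.cont.comp (by fun_prop) fun s (hs : 0 ≤ s) => mem_Ici.2 (by positivity)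
  strictMono := fun s (hs : 0 ≤ s) t (ht : 0 ≤ t) hst =>
    h.strictMono (mem_Ici.2 (by positivity)) (mem_Ici.2 (by positivity)) (by linarith)
  zero := by simpa using h.zero
  unbounded := by
    rintro ⟨M, hM⟩
    refine h.unbounded ⟨M, ?_⟩
    rintro _ ⟨s, hs : 0 ≤ s, rfl⟩
    have := hM (mem_image_of_mem _ (show s / 2 ∈ Ici (0 : ℝ) from mem_Ici.2 (by positivity)))
    simpa [mul_div_cancel₀] using this

theorem IsClassKInf.exists_ge {γ : ℝ → ℝ} (h : IsClassKInf γ) (M : ℝ) :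
    ∃ s, 0 ≤ s ∧ M ≤ γ s := by
  obtain ⟨_, ⟨s, hs, rfl⟩, hM⟩ := not_bddAbove_iff.1 h.unbounded M
  exact ⟨s, hs, hM.le⟩

/-- Class `K∞` functions are invertible on `[0, ∞)`, with inverses of class `K∞`. -/
theorem IsClassKInf.exists_inverse {γ : ℝ → ℝ} (h : IsClassKInf γ) :
    ∃ δ : ℝ → ℝ, IsClassKInf δ ∧ (∀ s, 0 ≤ s → δ (γ s) = s) ∧ ∀ s, 0 ≤ s → γ (δ s) = s := by
  -- Extended by the identity on `(-∞, 0]`, `γ` becomes an order automorphism of `ℝ`.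
  let f : ℝ → ℝ := fun s => γ (max s 0) + min s 0
  have hf : ∀ s, 0 ≤ s → f s = γ s := fun s hs => by simp [f, hs]
  have hmono : StrictMono f := by
    intro s t hst
    rcases lt_or_ge 0 t with ht | ht
    · have h1 : γ (max s 0) < γ (max t 0) :=
        h.strictMono (le_max_right s 0) (le_max_right t 0)
          (by rw [max_eq_left ht.le]; exact max_lt hst ht)
      have h2 : min s 0 ≤ min t 0 := min_le_min_right 0 hst.le
      exact add_lt_add_of_lt_of_le h1 h2
    · simp [f, ht, hst.le.trans ht, hst]
  have hcont : Continuous f :=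
    (h.cont.comp_continuous (by fun_prop) fun s => le_max_right s 0).add (by fun_prop)
  have hsurj : Function.Surjective f := by
    intro r
    obtain ⟨s, hs, hrs⟩ := h.exists_ge r
    refine mem_range_of_exists_le_of_exists_ge hcont ⟨min r 0, ?_⟩ ⟨s, by rwa [hf s hs]⟩
    simp [f, h.zero]
  let e : ℝ ≃o ℝ := hmono.orderIsoOfSurjective f hsurj
  have hfe : ∀ s, f (e.symm s) = s := e.apply_symm_apply
  have hef : ∀ s, e.symm (f s) = s := e.symm_apply_apply
  have he0 : e.symm 0 = 0 := by
    have h0 : f 0 = 0 := by rw [hf 0 le_rfl, h.zero]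
    simpa [h0] using hef 0
  have hpos : ∀ s, 0 ≤ s → 0 ≤ e.symm s := fun s hs => he0 ▸ e.symm.monotone hs
  refine ⟨e.symm, ⟨⟨e.symm.continuous.continuousOn, e.symm.strictMono.strictMonoOn _, he0⟩, ?_⟩,
    fun s hs => by rw [← hf s hs, hef], fun s hs => by rw [← hf _ (hpos s hs), hfe]⟩
  rintro ⟨M, hM⟩
  have h1 : (0 : ℝ) ≤ |M| + 1 := by positivity
  have := hM ⟨f (|M| + 1), by rw [hf _ h1]; exact h.nonneg h1, hef _⟩
  linarith [le_abs_self M]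

theorem IsClassKL.nonneg {κ : ℝ → ℝ → ℝ} (h : IsClassKL κ) {r t : ℝ} (hr : 0 ≤ r) (ht : 0 ≤ t) :
    0 ≤ κ r t :=
  (h.classK t ht).nonneg hr

theorem IsClassKL.classK_comp {κ : ℝ → ℝ → ℝ} {δ : ℝ → ℝ} (h : IsClassKL κ) (hδ : IsClassK δ) :
    IsClassKL (fun r t => δ (κ r t)) where
  cont := hδ.cont.comp h.cont fun p hp => h.nonneg hp.1 hp.2
  classK t ht :=
    { cont := hδ.cont.comp (h.classK t ht).cont fun r hr => h.nonneg hr ht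
      strictMono := fun r hr s hs hrs =>
        hδ.strictMono (h.nonneg hr ht) (h.nonneg hs ht) ((h.classK t ht).strictMono hr hs hrs)
      zero := by simp [(h.classK t ht).zero, hδ.zero] }
  classL r hr :=
    { cont := hδ.cont.comp (h.classL r hr).cont fun t ht => h.nonneg hr.le ht
      strictAnti := fun s hs t ht hst =>
        hδ.strictMono (h.nonneg hr.le ht) (h.nonneg hr.le hs) ((h.classL r hr).strictAnti hs ht hst)
      lim := by
        have h0 : Tendsto δ (𝓝[Ici 0] 0) (𝓝 0) := by
          simpa [ContinuousWithinAt, hδ.zero] using hδ.cont 0 self_mem_Ici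
        refine h0.comp (tendsto_nhdsWithin_iff.2 ⟨(h.classL r hr).lim, ?_⟩)
        filter_upwards [eventually_ge_atTop 0] with t ht using h.nonneg hr.le ht }

/-! ### Decay rates and the implicit decay estimate -/

/-- A decay rate: like a function of class `K`, but only monotone instead of strictly monotone. -/
structure IsDecayRate (a : ℝ → ℝ) : Prop where
  cont : ContinuousOn a (Ici 0)
  mono : MonotoneOn a (Ici 0)
  zero : a 0 = 0
  pos : ∀ s, 0 < s → 0 < a s

theorem IsClassK.isDecayRate {θ : ℝ → ℝ} (h : IsClassK θ) : IsDecayRate θ :=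
  ⟨h.cont, h.strictMono.monotoneOn, h.zero, fun _ => h.pos⟩

theorem IsDecayRate.comp_classK {θ δ : ℝ → ℝ} (h : IsDecayRate θ) (hδ : IsClassK δ) :
    IsDecayRate (fun s => θ (δ s)) where
  cont := h.cont.comp hδ.cont fun _ hs => hδ.nonneg hs
  mono s hs t ht hst := h.mono (hδ.nonneg hs) (hδ.nonneg ht) (hδ.mono hs hst)
  zero := by simp [hδ.zero, h.zero]
  pos s hs := h.pos _ (hδ.pos hs)

/-- A function that is continuous on `[0, R]`, vanishes at `0` and is positive on `(0, R]`
dominates a decay rate there. -/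
theorem exists_isDecayRate_le {d : ℝ → ℝ} {R : ℝ} (hR : 0 < R) (hd : ContinuousOn d (Icc 0 R))
    (h0 : d 0 = 0) (hpos : ∀ s, 0 < s → s ≤ R → 0 < d s) :
    ∃ θ, IsDecayRate θ ∧ ∀ s, 0 ≤ s → s ≤ R → θ s ≤ d s := by
  have hd0 : ∀ s, 0 ≤ s → s ≤ R → 0 ≤ d s := fun s hs hsR => by
    rcases hs.eq_or_lt with rfl | hs
    exacts [h0.ge, (hpos s hs hsR).le]
  -- The inf-convolution of `d` with the positive part: monotone, and positive away from `0`
  -- since for `s > 0` no point `z` makes both summands vanish.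
  let D : ℝ → ℝ := IccExtend hR.le (fun z : Icc (0 : ℝ) R => d z)
  have hDc : Continuous D := (continuousOn_iff_continuous_domRestrict.1 hd).Icc_extend'
  have hD : ∀ z ∈ Icc (0 : ℝ) R, D z = d z := fun z hz => IccExtend_of_mem _ _ hz
  let k : ℝ → ℝ → ℝ := fun s z => D z + max (s - z) 0
  have hkc : Continuous (Function.uncurry k) := by
    simp only [k, Function.uncurry_def]; fun_prop
  have hne : (Icc (0 : ℝ) R).Nonempty := nonempty_Icc.2 hR.le
  have hmin : ∀ s, ∃ z ∈ Icc (0 : ℝ) R, sInf (k s '' Icc 0 R) = k s z ∧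
      ∀ w ∈ Icc (0 : ℝ) R, k s z ≤ k s w := fun s =>
    isCompact_Icc.exists_sInf_image_eq_and_le hne (hkc.uncurry_left s).continuousOn
  have hle : ∀ s, ∀ w ∈ Icc (0 : ℝ) R, sInf (k s '' Icc 0 R) ≤ k s w := fun s w hw => by
    obtain ⟨z, -, hz, hzw⟩ := hmin s
    exact hz.le.trans (hzw w hw)
  have hnn : ∀ s z, z ∈ Icc (0 : ℝ) R → 0 ≤ k s z := fun s z hz =>
    add_nonneg (by rw [hD z hz]; exact hd0 z hz.1 hz.2) (le_max_right _ _)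
  refine ⟨fun s => sInf (k s '' Icc 0 R),
    ⟨(isCompact_Icc.continuous_sInf hkc).continuousOn, fun s _ t _ hst => ?_, ?_, fun s hs => ?_⟩,
    fun s hs hsR => ?_⟩
  · obtain ⟨z, hz, hz', -⟩ := hmin t
    refine (hle s z hz).trans (le_trans ?_ hz'.ge)
    simp only [k]
    gcongr
  · obtain ⟨z, hz, hz', -⟩ := hmin 0
    refine le_antisymm ((hle 0 0 (left_mem_Icc.2 hR.le)).trans ?_) (hz' ▸ hnn 0 z hz)
    simp [k, hD 0 (left_mem_Icc.2 hR.le), h0]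
  · obtain ⟨z, hz, hz', -⟩ := hmin s
    simp only [hz', k, hD z hz]
    rcases hz.1.eq_or_lt with rfl | hz0
    · simp [h0, hs]
    · exact add_pos_of_pos_of_nonneg (hpos z hz0 hz.2) (le_max_right _ _)
  · refine (hle s s ⟨hs, hsR⟩).trans ?_
    simp [k, hD s ⟨hs, hsR⟩]

/-- The solution `z` of `z + a (max z 0) * q = r`, unique for a decay rate `a` and `q ≥ 0`. It is an
upper bound at time `t` for nonincreasing functions `z` with `z' ≤ -g a(z)`, where `r` is the
initial value and `q = ∫₀ᵗ g`. -/
noncomputable def decayRoot (a : ℝ → ℝ) (r q : ℝ) : ℝ :=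
  Function.invFun (fun z => z + a (max z 0) * q) r

namespace IsDecayRate

variable {a : ℝ → ℝ}

theorem nonneg (ha : IsDecayRate a) {s : ℝ} (hs : 0 ≤ s) : 0 ≤ a s :=
  ha.zero ▸ ha.mono self_mem_Ici hs hs

theorem mono_max (ha : IsDecayRate a) {y z : ℝ} (h : y ≤ z) : a (max y 0) ≤ a (max z 0) :=
  ha.mono (le_max_right y 0) (le_max_right z 0) (max_le_max_right 0 h)

theorem continuous_max (ha : IsDecayRate a) : Continuous fun z => a (max z 0) :=
  ha.cont.comp_continuous (by fun_prop) fun z => le_max_right z 0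

theorem decayRoot_spec (ha : IsDecayRate a) (r : ℝ) {q : ℝ} (hq : 0 ≤ q) :
    decayRoot a r q + a (max (decayRoot a r q) 0) * q = r := by
  have hs : Function.Surjective fun z => z + a (max z 0) * q := by
    refine (continuous_id.add (ha.continuous_max.mul_const q)).surjective ?_ ?_
    · exact tendsto_atTop_mono
        (fun z => le_add_of_nonneg_right (mul_nonneg (ha.nonneg (le_max_right z 0)) hq)) tendsto_id
    · refine tendsto_id.congr' ?_
      filter_upwards [eventually_le_atBot 0] with z hz
      simp [hz, ha.zero]
  exact Function.rightInverse_invFun hs r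

theorem sub_le_sub (ha : IsDecayRate a) {y z q : ℝ} (hq : 0 ≤ q) (h : y ≤ z) :
    z - y ≤ (z + a (max z 0) * q) - (y + a (max y 0) * q) := by
  linarith [mul_le_mul_of_nonneg_right (ha.mono_max h) hq]

theorem abs_decayRoot_sub_le (ha : IsDecayRate a) (r z : ℝ) {q : ℝ} (hq : 0 ≤ q) :
    |decayRoot a r q - z| ≤ |r - (z + a (max z 0) * q)| := by
  have h := ha.decayRoot_spec r hq
  rcases le_total z (decayRoot a r q) with hz | hz
  · rw [abs_of_nonneg (sub_nonneg.2 hz)]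
    exact le_trans (by linarith [ha.sub_le_sub hq hz]) (le_abs_self _)
  · rw [abs_sub_comm, abs_of_nonneg (sub_nonneg.2 hz), abs_sub_comm]
    exact le_trans (by linarith [ha.sub_le_sub hq hz]) (le_abs_self _)

theorem le_decayRoot (ha : IsDecayRate a) {r z q : ℝ} (hq : 0 ≤ q)
    (h : z + a (max z 0) * q ≤ r) : z ≤ decayRoot a r q := by
  by_contra! hlt
  linarith [ha.sub_le_sub hq hlt.le, ha.decayRoot_spec r hq]

theorem decayRoot_strictMono (ha : IsDecayRate a) {q : ℝ} (hq : 0 ≤ q) :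
    StrictMono fun r => decayRoot a r q := by
  intro r s hrs
  by_contra! hle
  linarith [ha.sub_le_sub hq hle, ha.decayRoot_spec r hq, ha.decayRoot_spec s hq]

theorem decayRoot_zero (ha : IsDecayRate a) {q : ℝ} (hq : 0 ≤ q) : decayRoot a 0 q = 0 := by
  simpa [ha.zero] using ha.abs_decayRoot_sub_le 0 0 hq

theorem decayRoot_nonneg (ha : IsDecayRate a) {r q : ℝ} (hr : 0 ≤ r) (hq : 0 ≤ q) :
    0 ≤ decayRoot a r q :=
  ha.decayRoot_zero hq ▸ (ha.decayRoot_strictMono hq).monotone hr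

theorem decayRoot_anti (ha : IsDecayRate a) (r : ℝ) {p q : ℝ} (hp : 0 ≤ p) (hpq : p ≤ q) :
    decayRoot a r q ≤ decayRoot a r p := by
  refine ha.le_decayRoot hp ?_
  have := mul_le_mul_of_nonneg_left hpq (ha.nonneg (le_max_right (decayRoot a r q) 0))
  linarith [ha.decayRoot_spec r (hp.trans hpq)]

theorem continuousOn_decayRoot (ha : IsDecayRate a) :
    ContinuousOn (fun p : ℝ × ℝ => decayRoot a p.1 p.2) (univ ×ˢ Ici 0) := by
  rintro ⟨r, q⟩ ⟨-, hq : 0 ≤ q⟩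
  set z := decayRoot a r q
  have hlim : Tendsto (fun p : ℝ × ℝ => |p.1 - (z + a (max z 0) * p.2)|) (𝓝 (r, q)) (𝓝 0) := by
    have hc : Continuous fun p : ℝ × ℝ => |p.1 - (z + a (max z 0) * p.2)| := by fun_prop
    simpa [z, ha.decayRoot_spec r hq] using hc.tendsto (r, q)
  refine tendsto_iff_dist_tendsto_zero.2 (squeeze_zero' (.of_forall fun _ => dist_nonneg) ?_
    (hlim.mono_left nhdsWithin_le_nhds))
  filter_upwards [self_mem_nhdsWithin] with p hp
  exact ha.abs_decayRoot_sub_le p.1 z hp.2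

theorem tendsto_decayRoot (ha : IsDecayRate a) {r : ℝ} (hr : 0 ≤ r) :
    Tendsto (decayRoot a r) atTop (𝓝 0) := by
  refine (nhds_basis_Ioo_pos (0 : ℝ)).tendsto_right_iff.2 fun ε hε => ?_
  filter_upwards [eventually_gt_atTop (r / a ε), eventually_ge_atTop 0] with q hq hq0
  have h0 := ha.decayRoot_nonneg hr hq0
  refine ⟨by linarith, ?_⟩
  by_contra! hle
  rw [zero_add] at hle
  have h1 : a ε ≤ a (max (decayRoot a r q) 0) := 
    ha.mono hε.le (mem_Ici.2 (le_max_right _ 0)) (hle.trans (le_max_left _ 0))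
  have h2 := (div_lt_iff₀' (ha.pos ε hε)).1 hq
  linarith [ha.decayRoot_spec r hq0, mul_le_mul_of_nonneg_right h1 hq0]

/-- The summand `α r * exp (-t)` provides the strict decrease in `t` where `G` is constant. -/
theorem isClassKL_decayRoot (ha : IsDecayRate a) {α G : ℝ → ℝ} (hα : IsClassK α)
    (hGc : ContinuousOn G (Ici 0)) (hGm : MonotoneOn G (Ici 0)) (hG0 : 0 ≤ G 0)
    (hG : Tendsto G atTop atTop) :
    IsClassKL (fun r t => decayRoot a (α r) (G t) + α r * Real.exp (-t)) := by
  have hGn : ∀ t, 0 ≤ t → 0 ≤ G t := fun t ht => hG0.trans (hGm self_mem_Ici ht ht)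
  have hc : ContinuousOn
      (fun p : ℝ × ℝ => decayRoot a (α p.1) (G p.2) + α p.1 * Real.exp (-p.2))
      (Ici 0 ×ˢ Ici 0) := by
    have h1 : ContinuousOn (fun p : ℝ × ℝ => α p.1) (Ici 0 ×ˢ Ici 0) :=
      hα.cont.comp continuousOn_fst fun p hp => hp.1
    have h2 : ContinuousOn (fun p : ℝ × ℝ => G p.2) (Ici 0 ×ˢ Ici 0) :=
      hGc.comp continuousOn_snd fun p hp => hp.2
    exact (ha.continuousOn_decayRoot.comp (h1.prodMk h2) fun p hp => ⟨mem_univ _, hGn _ hp.2⟩).add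
      (h1.mul (by fun_prop))
  refine ⟨hc, fun t ht => ⟨?_, ?_, ?_⟩, fun r hr => ⟨?_, ?_, ?_⟩⟩
  · exact hc.comp (f := fun r => (r, t)) (by fun_prop) fun r hr => ⟨hr, ht⟩
  · intro r hr s hs hrs
    have h := hα.strictMono hr hs hrs
    exact add_lt_add (ha.decayRoot_strictMono (hGn t ht) h)
      (mul_lt_mul_of_pos_right h (Real.exp_pos _))
  · simp [hα.zero, ha.decayRoot_zero (hGn t ht)]
  · exact hc.comp (f := fun t => (r, t)) (by fun_prop) fun t ht => ⟨hr.le, ht⟩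
  · intro s hs t ht hst
    exact add_lt_add_of_le_of_lt (ha.decayRoot_anti _ (hGn s hs) (hGm hs ht hst.le))
      (mul_lt_mul_of_pos_left (Real.exp_lt_exp.2 (neg_lt_neg hst)) (hα.pos hr))
  · have h1 := (ha.tendsto_decayRoot (hα.nonneg hr.le)).comp hG
    have h2 := (Real.tendsto_exp_neg_atTop_nhds_zero).const_mul (α r)
    simpa using h1.add h2

end IsDecayRate

/-! ### The dissipation inequality along a trajectory -/

theorem MeasureTheory.LocallyIntegrableOn.intervalIntegrable_of_nonneg {g : ℝ → ℝ}
    (hg : LocallyIntegrableOn g (Ici 0)) {a b : ℝ} (ha : 0 ≤ a) (hb : 0 ≤ b) :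
    IntervalIntegrable g volume a b :=
  (intervalIntegrable_iff').2 <| hg.integrableOn_compact_subset
    (fun _ hx => (le_min ha hb).trans hx.1) isCompact_uIcc

theorem MeasureTheory.LocallyIntegrableOn.continuousOn_integral {g : ℝ → ℝ}
    (hg : LocallyIntegrableOn g (Ici 0)) :
    ContinuousOn (fun t => ∫ s in (0 : ℝ)..t, g s) (Ici 0) := by
  intro t (ht : 0 ≤ t)
  have h := intervalIntegral.continuousOn_primitive_interval'
    (hg.intervalIntegrable_of_nonneg le_rfl (add_nonneg ht zero_le_one)) left_mem_uIcc
  rw [uIcc_of_le (by positivity)] at h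
  refine (h t ⟨ht, by linarith⟩).mono_of_mem_nhdsWithin ?_
  filter_upwards [self_mem_nhdsWithin, mem_nhdsWithin_of_mem_nhds (Iic_mem_nhds (lt_add_one t))]
    with s h1 h2 using ⟨h1, h2⟩

theorem monotoneOn_integral {g : ℝ → ℝ} (hg : LocallyIntegrableOn g (Ici 0))
    (hg0 : ∀ t, 0 ≤ t → 0 ≤ g t) : MonotoneOn (fun t => ∫ s in (0 : ℝ)..t, g s) (Ici 0) := by
  intro s (hs : 0 ≤ s) t (ht : 0 ≤ t) hst
  have h := intervalIntegral.integral_add_adjacent_intervals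
    (hg.intervalIntegrable_of_nonneg le_rfl hs) (hg.intervalIntegrable_of_nonneg hs ht)
  have h2 : 0 ≤ ∫ x in s..t, g x :=
    intervalIntegral.integral_nonneg hst fun x hx => hg0 x (hs.trans hx.1)
  change (∫ x in (0 : ℝ)..s, g x) ≤ ∫ x in (0 : ℝ)..t, g x
  linarith

/-- An integrable upper bound of the derivative bounds the increment. -/
theorem sub_le_integral_of_deriv_le {y f : ℝ → ℝ} {s t : ℝ} (hst : s ≤ t)
    (hy : ContinuousOn y (Icc s t)) (hd : ∀ τ ∈ Ioo s t, DifferentiableAt ℝ y τ)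
    (hf : IntervalIntegrable f volume s t) (hle : ∀ τ ∈ Ioo s t, deriv y τ ≤ f τ) :
    y t - y s ≤ ∫ τ in s..t, f τ :=
  intervalIntegral.sub_le_integral_of_hasDeriv_right_of_le hst hy
    (fun τ hτ => (hd τ hτ).hasDerivAt.hasDerivWithinAt)
    ((intervalIntegrable_iff_integrableOn_Icc_of_le hst).1 hf) hle

/-- The comparison principle: `y' ≤ -g a(y) + v` yields a decay estimate with additive gain `∫ v`.
The function `w = y - ∫ v` is nonincreasing and below `y`, so `a(y)` stays above the final value
`a(w(t))` and integration gives `w(t) + a(w(t)) ∫ g ≤ y(0)`. -/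
theorem le_decayRoot_add_integral {a g v y : ℝ → ℝ} {t : ℝ} (ha : IsDecayRate a) (ht : 0 ≤ t)
    (hgi : IntervalIntegrable g volume 0 t) (hg : ∀ s, 0 ≤ s → 0 ≤ g s)
    (hvi : IntervalIntegrable v volume 0 t) (hv : ∀ s, 0 ≤ s → 0 ≤ v s)
    (hy : ContinuousOn y (Icc 0 t)) (hy0 : ∀ s, 0 ≤ s → s ≤ t → 0 ≤ y s)
    (hd : ∀ s ∈ Ioo 0 t, DifferentiableAt ℝ y s)
    (hle : ∀ s ∈ Ioo 0 t, deriv y s ≤ -g s * a (y s) + v s) :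
    y t ≤ decayRoot a (y 0) (∫ s in (0 : ℝ)..t, g s) + ∫ s in (0 : ℝ)..t, v s := by
  set w := y t - ∫ s in (0 : ℝ)..t, v s
  have hw : ∀ s ∈ Ioo 0 t, w ≤ y s := by
    rintro s ⟨hs, hst⟩
    have hv1 : IntervalIntegrable v volume 0 s :=
      hvi.mono_set (by rw [uIcc_of_le hs.le, uIcc_of_le ht]; exact Icc_subset_Icc_right hst.le)
    have hv2 : IntervalIntegrable v volume s t :=
      hvi.mono_set (by rw [uIcc_of_le hst.le, uIcc_of_le ht]; exact Icc_subset_Icc_left hs.le)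
    have h1 := sub_le_integral_of_deriv_le hst.le (hy.mono (Icc_subset_Icc_left hs.le))
      (fun τ hτ => hd τ ⟨hs.trans hτ.1, hτ.2⟩) hv2 fun τ hτ => by
        have hτ0 : 0 ≤ τ := (hs.trans hτ.1).le
        have := mul_nonneg (hg τ hτ0) (ha.nonneg (hy0 τ hτ0 hτ.2.le))
        linarith [hle τ ⟨hs.trans hτ.1, hτ.2⟩]
    have h2 := intervalIntegral.integral_add_adjacent_intervals hv1 hv2
    have h3 : 0 ≤ ∫ τ in (0 : ℝ)..s, v τ :=
      intervalIntegral.integral_nonneg hs.le fun τ hτ => hv τ hτ.1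
    simp only [w]
    linarith
  have hci : IntervalIntegrable (fun s => -(a (max w 0) * g s)) volume 0 t :=
    (hgi.const_mul _).neg
  have h := sub_le_integral_of_deriv_le (f := fun s => -(a (max w 0) * g s) + v s) ht hy hd
    (hci.add hvi) fun s hs => by
      have h1 : a (max w 0) ≤ a (y s) := by
        simpa [hy0 s hs.1.le hs.2.le] using ha.mono_max (hw s hs)
      linarith [hle s hs, mul_le_mul_of_nonneg_right h1 (hg s hs.1.le)]
  rw [intervalIntegral.integral_add hci hvi, intervalIntegral.integral_neg,
    intervalIntegral.integral_const_mul] at h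
  have := ha.le_decayRoot (r := y 0) (z := w)
    (intervalIntegral.integral_nonneg ht fun s hs => hg s hs.1) (by simp only [w] at h ⊢; linarith)
  simp only [w] at this
  linarith

/-- The gain functions attached to a Lyapunov functional with bounds `α₁`, `α₂`, decay rate `θ` and
decay coefficient `g`. Here `n` stands for the norm of the state and `y` for the value of the
functional along a trajectory. -/
theorem exists_gains_of_dissipation {α₁ α₂ θ g : ℝ → ℝ} (hα₁ : IsClassKInf α₁)
    (hα₂ : IsClassKInf α₂) (hθ : IsDecayRate θ) (hgi : LocallyIntegrableOn g (Ici 0))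
    (hg : ∀ t, 0 ≤ t → 0 ≤ g t)
    (hgtop : Tendsto (fun t : ℝ => ∫ s in (0 : ℝ)..t, g s) atTop atTop) :
    ∃ (σ : ℝ → ℝ) (β : ℝ → ℝ → ℝ), IsClassKInf σ ∧ IsClassKL β ∧
      ∀ (n y v : ℝ → ℝ) (t : ℝ), 0 ≤ t → (∀ s, 0 ≤ n s) →
        (∀ s, 0 ≤ s → s ≤ t → α₁ (n s) ≤ y s ∧ y s ≤ α₂ (n s)) →
        IntervalIntegrable v volume 0 t → (∀ s, 0 ≤ s → 0 ≤ v s) →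
        ContinuousOn y (Icc 0 t) → (∀ s ∈ Ioo 0 t, DifferentiableAt ℝ y s) →
        (∀ s ∈ Ioo 0 t, deriv y s ≤ -g s * θ (n s) + v s) →
        n t ≤ β (n 0) t + σ (∫ s in (0 : ℝ)..t, v s) := by
  obtain ⟨δ₁, hδ₁, hδα₁, -⟩ := hα₁.exists_inverse
  obtain ⟨δ₂, hδ₂, hδα₂, -⟩ := hα₂.exists_inverse
  have ha := hθ.comp_classK hδ₂.toIsClassK
  have hκ := ha.isClassKL_decayRoot hα₂.toIsClassK hgi.continuousOn_integral
    (monotoneOn_integral hgi hg) (by simp) hgtop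
  have hδ := hδ₁.comp_two_mul
  refine ⟨_, _, hδ, hκ.classK_comp hδ.toIsClassK, ?_⟩
  intro n y v t ht hn hy hvi hv hyc hd hle
  have hy0 : ∀ s, 0 ≤ s → s ≤ t → 0 ≤ y s := fun s hs hst =>
    (hα₁.nonneg (hn s)).trans (hy s hs hst).1
  have hG : 0 ≤ ∫ s in (0 : ℝ)..t, g s := intervalIntegral.integral_nonneg ht fun s hs => hg s hs.1
  have h1 := le_decayRoot_add_integral ha ht (hgi.intervalIntegrable_of_nonneg le_rfl ht) hg hvi hv
    hyc hy0 hd fun s hs => by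
      have h2 : θ (δ₂ (y s)) ≤ θ (n s) := by
        have hys := hy s hs.1.le hs.2.le
        have h0 := hy0 s hs.1.le hs.2.le
        refine hθ.mono (hδ₂.nonneg h0) (hn s) ?_
        simpa [hδα₂ _ (hn s)] using hδ₂.mono h0 hys.2
      linarith [hle s hs, mul_le_mul_of_nonneg_left h2 (hg s hs.1.le)]
  have h2 := (ha.decayRoot_strictMono hG).monotone (hy 0 le_rfl ht).2
  have h3 : 0 ≤ α₂ (n 0) * Real.exp (-t) := mul_nonneg (hα₂.nonneg (hn 0)) (Real.exp_pos _).le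
  set b := decayRoot (fun s => θ (δ₂ s)) (α₂ (n 0)) (∫ s in (0 : ℝ)..t, g s)
    + α₂ (n 0) * Real.exp (-t) with hb
  set I := ∫ s in (0 : ℝ)..t, v s
  have hb0 : 0 ≤ b := hκ.nonneg (hn 0) ht
  have hI : 0 ≤ I := intervalIntegral.integral_nonneg ht fun s hs => hv s hs.1
  have h4 : α₁ (n t) ≤ b + I := by
    have := (hy t ht le_rfl).1
    linarith
  -- The weak triangle inequality `δ (b + I) ≤ δ (2 b) + δ (2 I)`.
  have h5 : n t ≤ δ₁ (b + I) := by
    simpa [hδα₁ _ (hn t)] using hδ₁.mono (hα₁.nonneg (hn t)) h4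
  refine h5.trans ?_
  rcases le_total b I with h | h
  · exact (hδ₁.mono (by positivity) (by linarith)).trans
      (le_add_of_nonneg_left (hδ.nonneg hb0))
  · exact (hδ₁.mono (by positivity) (by linarith)).trans
      (le_add_of_nonneg_right (hδ.nonneg hI))

/-! ### Lyapunov functionals along classical solutions -/

namespace EvolutionSystem

variable {X U : Type*} [NormedAddCommGroup X] [NormedSpace ℝ X]

theorem IsClassicalSolution.continuousOn_Icc {S : EvolutionSystem X U} {x₀ : X} {u : ℝ → U}
    {T : EReal} {x : ℝ → X} (hx : S.IsClassicalSolution x₀ u T x) {t : ℝ} (htT : (t : EReal) < T) :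
    ContinuousOn x (Icc 0 t) :=
  hx.cont.mono fun _ hs => ⟨hs.1, (EReal.coe_le_coe_iff.2 hs.2).trans_lt htT⟩

theorem IsClassicalSolution.differentiableAt {S : EvolutionSystem X U} {x₀ : X} {u : ℝ → U}
    {T : EReal} {x : ℝ → X} (hx : S.IsClassicalSolution x₀ u T x) {t : ℝ} (ht : 0 < t)
    (htT : (t : EReal) < T) : DifferentiableAt ℝ x t :=
  let ⟨_, _, h⟩ := hx.ode t ht htT
  h.differentiableAt

theorem continuousOn_along {V : ℝ → X → ℝ}
    (hV : ContDiffOn ℝ 1 (fun p : ℝ × X => V p.1 p.2) (Ici 0 ×ˢ univ)) {x : ℝ → X} {t : ℝ}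
    (hx : ContinuousOn x (Icc 0 t)) : ContinuousOn (fun s => V s (x s)) (Icc 0 t) :=
  hV.continuousOn.comp (continuousOn_id.prodMk hx) fun _ hs => ⟨hs.1, mem_univ _⟩

theorem differentiableAt_along {V : ℝ → X → ℝ}
    (hV : ContDiffOn ℝ 1 (fun p : ℝ × X => V p.1 p.2) (Ici 0 ×ˢ univ)) {x : ℝ → X} {t : ℝ}
    (ht : 0 < t) (hx : DifferentiableAt ℝ x t) : DifferentiableAt ℝ (fun s => V s (x s)) t := by
  have h : DifferentiableAt ℝ (fun p : ℝ × X => V p.1 p.2) (t, x t) :=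
    (hV.contDiffAt (prod_mem_nhds (Ici_mem_nhds ht) univ_mem)).differentiableAt one_ne_zero
  exact h.comp t (f := fun s => (s, x s)) (differentiableAt_id.prodMk hx)

variable [NormedAddCommGroup U]

theorem intervalIntegrable_gain {φ : ℝ → ℝ} (hφ : IsClassK φ) {u : ℝ → U}
    (hu : ContinuousOn u (Ici 0)) {s t : ℝ} (hs : 0 ≤ s) (ht : 0 ≤ t) :
    IntervalIntegrable (fun s => φ ‖u s‖) volume s t :=
  ((hφ.cont.comp hu.norm fun _ _ => norm_nonneg _).mono
    fun _ hx => (le_min hs ht).trans hx.1).intervalIntegrable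

/-- As long as the state stays in the ball of radius `R'`, the growth term is dominated: there the
Lyapunov functional dissipates at a single rate `θ` with a single coefficient `g`. -/
theorem exists_decayRate_of_domination {g₁ g₂ θ₁ θ₂ : ℝ → ℝ} {R' : ℝ} (hR' : 0 < R')
    (hθ₁ : IsClassK θ₁) (hθ₂ : IsClassK θ₂) (hg₁ : ∀ t, 0 ≤ t → 0 ≤ g₁ t)
    (hg₂ : ∀ t, 0 ≤ t → 0 ≤ g₂ t) (hi₁ : LocallyIntegrableOn g₁ (Ici 0))
    (hi₂ : LocallyIntegrableOn g₂ (Ici 0))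
    (htop : Tendsto (fun t : ℝ => ∫ τ in (0 : ℝ)..t, g₁ τ) atTop atTop)
    (hg : ∀ t, 0 ≤ t → g₂ t ≤ g₁ t) (hθ : ∀ s, 0 ≤ s → s ≤ R' → θ₂ s ≤ θ₁ s)
    (hor : (∀ s, 0 < s → s ≤ R' → θ₂ s < θ₁ s) ∨
      Tendsto (fun t : ℝ => ∫ τ in (0 : ℝ)..t, (g₁ τ - g₂ τ)) atTop atTop) :
    ∃ θ g : ℝ → ℝ, IsDecayRate θ ∧ LocallyIntegrableOn g (Ici 0) ∧ (∀ t, 0 ≤ t → 0 ≤ g t) ∧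
      Tendsto (fun t : ℝ => ∫ τ in (0 : ℝ)..t, g τ) atTop atTop ∧
      ∀ t s, 0 ≤ t → 0 ≤ s → s ≤ R' → -g₁ t * θ₁ s + g₂ t * θ₂ s ≤ -g t * θ s := by
  rcases hor with hlt | htop'
  · obtain ⟨θ, hθ', hle⟩ := exists_isDecayRate_le (d := fun s => θ₁ s - θ₂ s) hR'
      ((hθ₁.cont.sub hθ₂.cont).mono Icc_subset_Ici_self) (by simp [hθ₁.zero, hθ₂.zero])
      fun s hs hsR => sub_pos.2 (hlt s hs hsR)
    refine ⟨θ, g₁, hθ', hi₁, hg₁, htop, fun t s ht hs hsR => ?_⟩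
    linarith [mul_le_mul_of_nonneg_left (hle s hs hsR) (hg₁ t ht),
      mul_le_mul_of_nonneg_right (hg t ht) (hθ₂.nonneg hs)]
  · refine ⟨θ₁, fun t => g₁ t - g₂ t, hθ₁.isDecayRate, hi₁.sub hi₂,
      fun t ht => sub_nonneg.2 (hg t ht), htop', fun t s ht hs hsR => ?_⟩
    linarith [mul_le_mul_of_nonneg_left (hθ s hs hsR) (hg₂ t ht)]

theorem IsIISSLyapunov.isIISS {S : EvolutionSystem X U} {V : ℝ → X → ℝ}
    (hV : S.IsIISSLyapunov V) : S.IsIISS := by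
  obtain ⟨g₁, g₂, hV, hg₂⟩ := hV
  obtain ⟨α₁, α₂, hα₁, hα₂, hα⟩ := hV.sandwich
  obtain ⟨θ₁, θ₂, φ, R', hθ₁, -, hφ, -, -, -, hdiss⟩ := hV.dissipation
  obtain ⟨σ, β, hσ, hβ, hest⟩ := exists_gains_of_dissipation hα₁ hα₂ hθ₁.isDecayRate hV.locInt₁
    hV.nonneg₁ hV.integral_top
  refine ⟨φ, σ, β, hφ, hσ, hβ, fun x₀ u hx₀ hu T x hT hx t ht htT => ?_⟩
  have hsT : ∀ s ∈ Ioo 0 t, (s : EReal) < T := fun s hs =>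
    (EReal.coe_lt_coe_iff.2 hs.2).trans htT
  rw [← hx.init]
  refine hest (fun s => ‖x s‖) (fun s => V s (x s)) _ t ht (fun s => norm_nonneg _)
    (fun s hs _ => hα s (x s) hs) (intervalIntegrable_gain hφ hu le_rfl ht)
    (fun s _ => hφ.nonneg (norm_nonneg _)) (continuousOn_along hV.contDiff
      (hx.continuousOn_Icc htT)) (fun s hs => differentiableAt_along hV.contDiff hs.1
      (hx.differentiableAt hs.1 (hsT s hs))) fun s hs => ?_
  simpa [hg₂ s hs.1.le] using hdiss x₀ u T x hx₀ hu hT hx s hs.1 (hsT s hs)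

theorem IsLiISSLyapunov.isLiISS {S : EvolutionSystem X U} {V : ℝ → X → ℝ}
    (hV : S.IsLiISSLyapunov V) : S.IsLiISS := by
  obtain ⟨g₁, g₂, hV⟩ := hV
  obtain ⟨α₁, α₂, hα₁, hα₂, hα⟩ := hV.sandwich
  obtain ⟨θ₁, θ₂, φ, R', hθ₁, hθ₂, hφ, hR', hθ, hor, hdiss⟩ := hV.dissipation
  obtain ⟨θ, g, hθd, hgi, hg, hgtop, hdom⟩ := exists_decayRate_of_domination hR' hθ₁ hθ₂ hV.nonneg₁
    hV.nonneg₂ hV.locInt₁ hV.locInt₂ hV.integral_top hV.le hθ hor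
  obtain ⟨σ, β, hσ, hβ, hest⟩ := exists_gains_of_dissipation hα₁ hα₂ hθd hgi hg hgtop
  -- The radius `R` is such that `V` cannot climb from the ball of radius `R` to the level
  -- `α₁ R'` when the input contributes at most `R`.
  obtain ⟨R, hR, hRR'⟩ : ∃ R, 0 < R ∧ α₂ R + R < α₁ R' := by
    have hc : Tendsto (fun s => α₂ s + s) (𝓝[>] 0) (𝓝 0) := by
      have : ContinuousWithinAt (fun s => α₂ s + s) (Ici 0) 0 :=
        (hα₂.cont.add continuousOn_id) 0 self_mem_Ici
      simpa [ContinuousWithinAt, hα₂.zero] using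
        this.tendsto.mono_left (nhdsWithin_mono _ Ioi_subset_Ici_self)
    obtain ⟨R, h1, h2⟩ := ((hc.eventually_lt_const (hα₁.pos hR')).and self_mem_nhdsWithin).exists
    exact ⟨R, h2, h1⟩
  refine ⟨φ, σ, β, hφ, hσ, hβ, R, φ, fun s => s, hR, hφ, isClassKInf_id,
    fun x₀ u hx₀ hu hsmall T x hT hx t ht htT => ?_⟩
  have hv : ∀ s : ℝ, 0 ≤ s → 0 ≤ φ ‖u s‖ := fun s _ => hφ.nonneg (norm_nonneg _)
  have hcont := hx.continuousOn_Icc htT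
  have hyc := continuousOn_along hV.contDiff hcont
  have hsT : ∀ s ∈ Ioo 0 t, (s : EReal) < T := fun s hs =>
    (EReal.coe_lt_coe_iff.2 hs.2).trans htT
  have hyd : ∀ s ∈ Ioo 0 t, DifferentiableAt ℝ (fun s => V s (x s)) s := fun s hs =>
    differentiableAt_along hV.contDiff hs.1 (hx.differentiableAt hs.1 (hsT s hs))
  have hloc : ∀ s ∈ Ioo 0 t, ‖x s‖ ≤ R' →
      deriv (fun s => V s (x s)) s ≤ -g s * θ ‖x s‖ + φ ‖u s‖ := fun s hs hs' => by
    linarith [hdiss x₀ u T x hx₀ hu hT hx s hs.1 (hsT s hs),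
      hdom s ‖x s‖ hs.1.le (norm_nonneg _) hs']
  have hx0 : ‖x₀‖ ≤ R := by
    have h1 := hsmall 1 one_pos
    have h2 : 0 ≤ ∫ s in (0 : ℝ)..1, φ ‖u s‖ :=
      intervalIntegral.integral_nonneg zero_le_one fun s hs => hv s hs.1
    linarith
  -- The state cannot leave the ball of radius `R'`: consider the first time it reaches the sphere.
  have htrap : ∀ s ∈ Icc 0 t, ‖x s‖ ≤ R' := by
    by_contra! hex
    obtain ⟨t₁, ht₁, hxt₁⟩ := hex
    have hcl : IsCompact (Icc 0 t ∩ (fun s => ‖x s‖) ⁻¹' Ici R') :=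
      isCompact_Icc.of_isClosed_subset
        (hcont.norm.preimage_isClosed_of_isClosed isClosed_Icc isClosed_Ici) inter_subset_left
    obtain ⟨τ, ⟨hτ, hxτ⟩, hleast⟩ := hcl.exists_isLeast ⟨t₁, ht₁, hxt₁.le⟩
    have hin : ∀ s ∈ Ioo 0 τ, ‖x s‖ ≤ R' := fun s hs => by
      by_contra! h
      exact absurd (hleast ⟨⟨hs.1.le, hs.2.le.trans hτ.2⟩, h.le⟩) (not_le.2 hs.2)
    have hinc := sub_le_integral_of_deriv_le hτ.1 (hyc.mono (Icc_subset_Icc_right hτ.2))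
      (fun s hs => hyd s ⟨hs.1, hs.2.trans_le hτ.2⟩) (intervalIntegrable_gain hφ hu le_rfl hτ.1)
      fun s hs => by
        have := mul_nonneg (hg s hs.1.le) (hθd.nonneg (norm_nonneg (x s)))
        linarith [hloc s ⟨hs.1, hs.2.trans_le hτ.2⟩ (hin s hs)]
    have h0 : V 0 (x 0) ≤ α₂ R := by
      rw [hx.init]
      exact (hα 0 x₀ le_rfl).2.trans (hα₂.mono (norm_nonneg _) hx0)
    have hI : ∫ s in (0 : ℝ)..τ, φ ‖u s‖ ≤ R := by
      rcases hτ.1.eq_or_lt with rfl | hτ0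
      · simpa using hR.le
      · linarith [hsmall τ hτ0, norm_nonneg x₀]
    linarith [(hα τ (x τ) hτ.1).1, hα₁.mono hR'.le hxτ]
  rw [← hx.init]
  exact hest (fun s => ‖x s‖) (fun s => V s (x s)) _ t ht (fun s => norm_nonneg _)
    (fun s hs _ => hα s (x s) hs) (intervalIntegrable_gain hφ hu le_rfl ht) hv hyc hyd
    fun s hs => hloc s hs (htrap s (Ioo_subset_Icc_self hs))

end EvolutionSystem

theorem theorem1 {X U : Type*} [NormedAddCommGroup X] [NormedSpace ℝ X] [CompleteSpace X]
    [NormedAddCommGroup U] [NormedSpace ℝ U] (S : EvolutionSystem X U) :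
    ((∃ V : ℝ → X → ℝ, S.IsLiISSLyapunov V) → S.IsLiISS) ∧
    ((∃ V : ℝ → X → ℝ, S.IsIISSLyapunov V) → S.IsIISS) :=
  ⟨fun ⟨_, hV⟩ => hV.isLiISS, fun ⟨_, hV⟩ => hV.isIISS⟩
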